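/- **Theorem 2.1.** Let $n$ be a positive integer, let $\Pi_n\subset\mathbb R^n$ be the closed simplex of probability vectors, $\Pi_{n,++}$ the subset of those with all coordinates positive, and $\partial\Pi_n=\Pi_n\setminus\Pi_{n,++}$. For $v\in\mathbb R^n$ let $D(v)$ be the diagonal matrix with diagonal $v$. Let $A$ be a real $n\times n$ matrix with nonnegative entries and no zero row or zero column, and let $a\in\Pi_{n,++}$. Then $$\Phi_{A,a}(x)=D(x)\,A\,D(A^{\top}x)^{-1}a$$ defines a smooth map $\Phi_{A,a}:\Pi_{n,++}\to\Pi_{n,++}$, and the following hold. 1. Suppose that all entries of $A$ are positive. Then $\Phi_{A,a}$ extends to a continuous map $\Pi_n\to\Pi_n$ which maps $\partial\Pi_n$ into $\partial\Pi_n$, and $\Phi_{A,a}$ is a diffeomorphism of $\Pi_{n,++}$ onto itself. Consequently the discrete Schrödinger bridge problem is uniquely solvable: for every $b\in\Pi_{n,++}$ there are vectors $u,v,x,y$ with positive entries such that $$v=A^{\top}u,\qquad y=Ax,\qquad a=v\circ x,\qquad b=u\circ y$$ ($\circ$ is the entrywise product), and every positive solution has the form $(tu,tv,t^{-1}x,t^{-1}y)$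 with $t>0$. Equivalently, there are diagonal matrices $D_1,D_2$ with positive diagonal entries such that $B=D_1AD_2$ is column stochastic and $Ba=b$, and the pair $(D_1,D_2)$ is unique up to replacing it by $(tD_1,t^{-1}D_2)$, $t>0$. 2. Suppose that $AA^{\top}$ is irreducible. Then $\Phi_{A,a}(\Pi_{n,++})$ is an open subset of $\Pi_{n,++}$, and $\Phi_{A,a}$ is a diffeomorphism of $\Pi_{n,++}$ onto $\Phi_{A,a}(\Pi_{n,++})$. -/

import Mathlib

open scoped Matrix ContDiff

/-- The open simplex `Π_{n,++}` of positive probability vectors. The closed simplex `Π_n` is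
`stdSimplex ℝ (Fin n)`. -/
def openSimplex (n : ℕ) : Set (Fin n → ℝ) :=
  {x | x ∈ stdSimplex ℝ (Fin n) ∧ ∀ i, 0 < x i}

/-- The boundary `∂Π_n` of the simplex: the closed simplex minus the open simplex. -/
def simplexBoundary (n : ℕ) : Set (Fin n → ℝ) :=
  stdSimplex ℝ (Fin n) \ openSimplex n

/-- The matrix `Φ_A(x) = D(x) A D(Aᵀ x)⁻¹`. -/
noncomputable def scalingMatrix {n : ℕ} (A : Matrix (Fin n) (Fin n) ℝ) (x : Fin n → ℝ) :
    Matrix (Fin n) (Fin n) ℝ :=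
  Matrix.diagonal x * A * (Matrix.diagonal (Aᵀ *ᵥ x))⁻¹

/-- The map `Φ_{A,a}(x) = Φ_A(x) a`. -/
noncomputable def scalingMap {n : ℕ} (A : Matrix (Fin n) (Fin n) ℝ) (a x : Fin n → ℝ) :
    Fin n → ℝ :=
  scalingMatrix A x *ᵥ a

/-- Smoothness of a map on an arbitrary subset `S` of a normed space: near each point of `S` the
map is the restriction to `S` of a `C^∞` map defined on an open set of the ambient space. On an
embedded submanifold this is smoothness for the manifold structure. -/
def SmoothOnSubset {E F : Type*} [NormedAddCommGroup E] [NormedSpace ℝ E]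
    [NormedAddCommGroup F] [NormedSpace ℝ F] (f : E → F) (S : Set E) : Prop :=
  ∀ x ∈ S, ∃ U : Set E, IsOpen U ∧ x ∈ U ∧
    ∃ g : E → F, ContDiffOn ℝ ∞ g U ∧ Set.EqOn f g (S ∩ U)

/-- `f` restricts to a diffeomorphism of the subset `S` onto the subset `T`: a smooth bijection
of `S` onto `T` with smooth inverse. -/
def IsDiffeomorphismOn {E F : Type*} [NormedAddCommGroup E] [NormedSpace ℝ E]
    [NormedAddCommGroup F] [NormedSpace ℝ F] (f : E → F) (S : Set E) (T : Set F) : Prop :=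
  Set.MapsTo f S T ∧ SmoothOnSubset f S ∧
    ∃ g : F → E, Set.MapsTo g T S ∧ SmoothOnSubset g T ∧ Set.InvOn g f S T

/-- `u, v, x, y` are positive vectors solving the discrete Schrödinger bridge system
`v = Aᵀ u`, `y = A x`, `a = v ∘ x`, `b = u ∘ y` (`∘` is the entrywise product). -/
def IsBridgeSolution {n : ℕ} (A : Matrix (Fin n) (Fin n) ℝ) (a b u v x y : Fin n → ℝ) : Prop :=
  (∀ i, 0 < u i) ∧ (∀ i, 0 < v i) ∧ (∀ i, 0 < x i) ∧ (∀ i, 0 < y i) ∧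
    v = Aᵀ *ᵥ u ∧ y = A *ᵥ x ∧ a = v * x ∧ b = u * y

/-- `d₁, d₂` are the diagonals of positive diagonal matrices `D₁, D₂` such that `B = D₁ A D₂` is
(column) stochastic and `B a = b`. -/
def IsBridgeScaling {n : ℕ} (A : Matrix (Fin n) (Fin n) ℝ) (a b d₁ d₂ : Fin n → ℝ) : Prop :=
  (∀ i, 0 < d₁ i) ∧ (∀ i, 0 < d₂ i) ∧
    Matrix.diagonal d₁ * A * Matrix.diagonal d₂ ∈ Matrix.colStochastic ℝ (Fin n) ∧
    (Matrix.diagonal d₁ * A * Matrix.diagonal d₂) *ᵥ a = b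

/-! On positive vectors the map is φ(x)_i = x_i ∑_j A_ij a_j / (Aᵀx)_j, homogeneous of degree 0 with
coordinate sum ∑ a = 1. The map (∑ x) φ(x), `homogeneousScaling`, preserves the coordinate sum and
agrees with φ on the simplex, so the inverse function theorem can be used on the open orthant of the
whole space (`isOpen_image_and_contDiffOn_invFunOn`).

Injectivity of this map and of its derivative both rest on the maximum principle
`eq_of_sum_sub_average_eq_zero`, applied to η = z/x for two points with the same φ and to η = h/x
for a direction h along which φ has derivative zero. Irreducibility of A Aᵀ gives the connectedness
it needs.

For positive A, φ(x) = b is the critical point equation of ∑ b_i log x_i - ∑ a_j log (Aᵀx)_j. The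
exponential of this potential vanishes on the boundary of the simplex, so an interior maximum exists
and φ is onto. Bridge solutions and scalings are determined by u, respectively D₁, which solves φ(u)
= b and is unique up to a positive factor. -/

open Filter Topology Finset

/-- The open positive orthant. -/
def posOrthant (n : ℕ) : Set (Fin n → ℝ) := {x | ∀ i, 0 < x i}

/-- The scaling map written without matrix inverses. -/
noncomputable def scalingFormula {n : ℕ} (A : Matrix (Fin n) (Fin n) ℝ) (a x : Fin n → ℝ) :
    Fin n → ℝ :=
  fun i => x i * ∑ j, A i j * (a j / (Aᵀ *ᵥ x) j)

/-- The extension of the scaling map from the simplex which is homogeneous of degree one. -/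
noncomputable def homogeneousScaling {n : ℕ} (A : Matrix (Fin n) (Fin n) ℝ) (a x : Fin n → ℝ) :
    Fin n → ℝ :=
  fun i => (∑ k, x k) * scalingFormula A a x i

/-- The graph on the rows of `A`, with two rows joined when they are both positive in some column,
is connected. -/
def RowsConnected {n : ℕ} (A : Matrix (Fin n) (Fin n) ℝ) : Prop :=
  ∀ p : Fin n → Prop, (∀ i j k, p i → 0 < A i j → 0 < A k j → p k) → ∀ i k, p i → p k

/-! ### Elementary properties of the scaling map -/

section Basic

variable {n : ℕ} {A : Matrix (Fin n) (Fin n) ℝ} {a x : Fin n → ℝ}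

theorem transpose_mulVec_apply (A : Matrix (Fin n) (Fin n) ℝ) (x : Fin n → ℝ) (j : Fin n) :
    (Aᵀ *ᵥ x) j = ∑ k, A k j * x k := rfl

theorem scalingFormula_eq_mul (A : Matrix (Fin n) (Fin n) ℝ) (a x : Fin n → ℝ) :
    scalingFormula A a x = x * (A *ᵥ ((fun j => ((Aᵀ *ᵥ x) j)⁻¹) * a)) := by
  have : (fun j => ((Aᵀ *ᵥ x) j)⁻¹) * a = fun j => a j / (Aᵀ *ᵥ x) j :=
    funext fun j => (div_eq_inv_mul _ _).symm
  rw [this]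
  rfl

theorem transpose_mulVec_pos (hA : ∀ i j, 0 ≤ A i j) (hcol : ∀ j, ∃ i, A i j ≠ 0)
    (hx : ∀ i, 0 < x i) (j : Fin n) : 0 < (Aᵀ *ᵥ x) j := by
  rw [transpose_mulVec_apply]
  obtain ⟨i, hi⟩ := hcol j
  exact sum_pos' (fun k _ => mul_nonneg (hA k j) (hx k).le)
    ⟨i, mem_univ i, mul_pos ((hA i j).lt_of_ne' hi) (hx i)⟩

theorem transpose_mulVec_pos_of_mem_stdSimplex (hA : ∀ i j, 0 < A i j)
    (hx : x ∈ stdSimplex ℝ (Fin n)) (j : Fin n) : 0 < (Aᵀ *ᵥ x) j := by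
  rw [transpose_mulVec_apply]
  obtain ⟨i, hi⟩ : ∃ i, x i ≠ 0 := by
    by_contra! h
    simpa [h] using hx.2
  exact sum_pos' (fun k _ => mul_nonneg (hA k j).le (hx.1 k))
    ⟨i, mem_univ i, mul_pos (hA i j) ((hx.1 i).lt_of_ne' hi)⟩

theorem scalingMap_eq_scalingFormula (h : ∀ j, (Aᵀ *ᵥ x) j ≠ 0) :
    scalingMap A a x = scalingFormula A a x := by
  have hu : IsUnit (Aᵀ *ᵥ x) := Pi.isUnit_iff.2 fun j => (h j).isUnit
  have hinv : (Matrix.diagonal (Aᵀ *ᵥ x))⁻¹ = Matrix.diagonal (fun j => ((Aᵀ *ᵥ x) j)⁻¹) := by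
    apply Matrix.inv_eq_right_inv
    rw [Matrix.diagonal_mul_diagonal, ← Matrix.diagonal_one]
    congr 1
    funext j
    exact mul_inv_cancel₀ (h j)
  funext i
  rw [scalingMap, scalingMatrix, hinv, ← Matrix.mulVec_mulVec, ← Matrix.mulVec_mulVec,
    Matrix.mulVec_diagonal, scalingFormula_eq_mul, Pi.mul_apply]
  congr 3
  funext j
  rw [Matrix.mulVec_diagonal, Pi.mul_apply]

theorem sum_scalingFormula (h : ∀ j, (Aᵀ *ᵥ x) j ≠ 0) :
    ∑ i, scalingFormula A a x i = ∑ j, a j := by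
  simp only [scalingFormula, mul_sum]
  rw [sum_comm]
  refine sum_congr rfl fun j _ => ?_
  have : ∀ i, x i * (A i j * (a j / (Aᵀ *ᵥ x) j)) = A i j * x i * (a j / (Aᵀ *ᵥ x) j) :=
    fun i => by ring
  simp only [this]
  rw [← sum_mul, ← transpose_mulVec_apply, mul_div_cancel₀ _ (h j)]

theorem scalingFormula_pos (hA : ∀ i j, 0 ≤ A i j) (hrow : ∀ i, ∃ j, A i j ≠ 0)
    (ha : ∀ j, 0 < a j) (hT : ∀ j, 0 < (Aᵀ *ᵥ x) j) {i : Fin n} (hx : 0 < x i) :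
    0 < scalingFormula A a x i := by
  obtain ⟨j, hj⟩ := hrow i
  exact mul_pos hx (sum_pos' (fun k _ => mul_nonneg (hA i k) (div_pos (ha k) (hT k)).le)
    ⟨j, mem_univ j, mul_pos ((hA i j).lt_of_ne' hj) (div_pos (ha j) (hT j))⟩)

theorem scalingFormula_mem_stdSimplex (hA : ∀ i j, 0 ≤ A i j) (ha : a ∈ stdSimplex ℝ (Fin n))
    (hT : ∀ j, 0 < (Aᵀ *ᵥ x) j) (hx : ∀ i, 0 ≤ x i) :
    scalingFormula A a x ∈ stdSimplex ℝ (Fin n) :=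
  ⟨fun i => mul_nonneg (hx i) (sum_nonneg fun k _ =>
      mul_nonneg (hA i k) (div_nonneg (ha.1 k) (hT k).le)),
    (sum_scalingFormula fun j => (hT j).ne').trans ha.2⟩

theorem isOpen_posOrthant (n : ℕ) : IsOpen (posOrthant n) := by
  simp only [posOrthant, Set.ofPred_forall]
  exact isOpen_iInter_of_finite fun i => isOpen_lt continuous_const (continuous_apply i)

theorem contDiffAt_scalingFormula (h : ∀ j, (Aᵀ *ᵥ x) j ≠ 0) :
    ContDiffAt ℝ ∞ (scalingFormula A a) x := by
  rw [contDiffAt_pi]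
  intro i
  have hT : ∀ j, ContDiffAt ℝ ∞ (fun y => (Aᵀ *ᵥ y) j) x := fun j => by
    simp only [transpose_mulVec_apply]
    fun_prop
  exact (contDiff_apply ℝ ℝ i).contDiffAt.mul (ContDiffAt.sum fun j _ =>
    contDiffAt_const.mul (contDiffAt_const.div (hT j) (h j)))

theorem contDiffAt_homogeneousScaling (h : ∀ j, (Aᵀ *ᵥ x) j ≠ 0) :
    ContDiffAt ℝ ∞ (homogeneousScaling A a) x := by
  rw [contDiffAt_pi]
  intro i
  have hs : ContDiffAt ℝ ∞ (fun y : Fin n → ℝ => ∑ k, y k) x := by fun_prop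
  exact hs.mul (contDiffAt_pi.1 (contDiffAt_scalingFormula h) i)

theorem smoothOnSubset_scalingMap (hA : ∀ i j, 0 ≤ A i j) (hcol : ∀ j, ∃ i, A i j ≠ 0) :
    SmoothOnSubset (scalingMap A a) (openSimplex n) := fun _ hx =>
  ⟨posOrthant n, isOpen_posOrthant n, hx.2, scalingFormula A a,
    fun _ hy => (contDiffAt_scalingFormula fun j =>
      (transpose_mulVec_pos hA hcol hy j).ne').contDiffWithinAt,
    fun _ hy => scalingMap_eq_scalingFormula fun j => (transpose_mulVec_pos hA hcol hy.2 j).ne'⟩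

theorem mapsTo_scalingMap (hA : ∀ i j, 0 ≤ A i j) (hrow : ∀ i, ∃ j, A i j ≠ 0)
    (hcol : ∀ j, ∃ i, A i j ≠ 0) (ha : a ∈ openSimplex n) :
    Set.MapsTo (scalingMap A a) (openSimplex n) (openSimplex n) := fun x hx => by
  have hT := transpose_mulVec_pos hA hcol hx.2
  rw [scalingMap_eq_scalingFormula fun j => (hT j).ne']
  exact ⟨scalingFormula_mem_stdSimplex hA ha.1 hT hx.1.1,
    fun i => scalingFormula_pos hA hrow ha.2 hT (hx.2 i)⟩

end Basic

/-! ### Connectedness of rows and the maximum principle -/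

section Connected

variable {n : ℕ} {A : Matrix (Fin n) (Fin n) ℝ}

theorem rowsConnected_of_pos (hA : ∀ i j, 0 < A i j) : RowsConnected A :=
  fun _ hp i k hi => hp i i k hi (hA i i) (hA k i)

/-- A positive entry (b, c) of A Aᵀ forces a column in which rows b and c are both positive; the
property then spreads along a path in the quiver of A Aᵀ. -/
theorem rowsConnected_of_isIrreducible (hA : ∀ i j, 0 ≤ A i j)
    (h : (A * Aᵀ).IsIrreducible) : RowsConnected A := by
  intro p hp i k hi
  let : Quiver (Fin n) := (A * Aᵀ).toQuiver
  obtain ⟨q, -⟩ := h.connected i k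
  induction q with
  | nil => exact hi
  | @cons b c _ e ih =>
    have he : 0 < (A * Aᵀ) b c := e.down
    rw [Matrix.mul_apply] at he
    obtain ⟨j, -, hj⟩ := exists_lt_of_sum_lt (by simpa using he :
      ∑ _j : Fin n, (0 : ℝ) < ∑ j, A b j * Aᵀ j c)
    exact hp b j c ih (pos_of_mul_pos_left hj (hA c j)) (pos_of_mul_pos_right hj (hA b j))

/-- A maximum principle: a function which at every row is an average of its column averages is
constant. -/
theorem eq_of_sum_sub_average_eq_zero (hA : ∀ i j, 0 ≤ A i j) (hconn : RowsConnected A)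
    {x c η m : Fin n → ℝ} (hx : ∀ i, 0 < x i) (hc : ∀ j, 0 < c j)
    (hm : ∀ j, m j * ∑ k, A k j * x k = ∑ k, A k j * x k * η k)
    (hη : ∀ i, ∑ j, A i j * c j * (η i - m j) = 0) (i k : Fin n) : η i = η k := by
  have : Nonempty (Fin n) := ⟨i⟩
  obtain ⟨l, hl⟩ := Finite.exists_max η
  have key : ∀ r, ∀ s, η s ≤ η r := by
    intro r
    -- The rows where η is maximal are closed under adjacency: there η i dominates every column
    -- average, so all terms of `hη i` are nonnegative and vanish.
    refine hconn (fun i => ∀ s, η s ≤ η i) (fun i j k hi hij hkj => ?_) l r hl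
    have hmean : ∀ j, (η i - m j) * ∑ k, A k j * x k = ∑ k, A k j * x k * (η i - η k) := by
      intro j
      simp only [mul_sub, sum_sub_distrib, sub_mul, hm, ← sum_mul]
      ring
    have hnn : ∀ j k, 0 ≤ A k j * x k * (η i - η k) := fun j k =>
      mul_nonneg (mul_nonneg (hA k j) (hx k).le) (sub_nonneg.2 (hi k))
    have hterm : ∀ j ∈ univ, 0 ≤ A i j * c j * (η i - m j) := by
      intro j _
      rcases (hA i j).eq_or_lt with h0 | h0
      · simp [← h0]
      · have hS : 0 < ∑ k, A k j * x k := sum_pos' (fun k _ => mul_nonneg (hA k j) (hx k).le)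
          ⟨i, mem_univ i, mul_pos h0 (hx i)⟩
        have : 0 ≤ (η i - m j) * ∑ k, A k j * x k := by
          rw [hmean]
          exact sum_nonneg fun k _ => hnn j k
        exact mul_nonneg (mul_pos h0 (hc j)).le (nonneg_of_mul_nonneg_left this hS)
    have hz := (sum_eq_zero_iff_of_nonneg hterm).1 (hη i) j (mem_univ j)
    have hmj : η i - m j = 0 :=
      (mul_eq_zero.1 hz).resolve_left (mul_pos hij (hc j)).ne'
    have hs := hmean j
    rw [hmj, zero_mul, eq_comm, sum_eq_zero_iff_of_nonneg fun k _ => hnn j k] at hs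
    have := (mul_eq_zero.1 (hs k (mem_univ k))).resolve_left (mul_pos hkj (hx k)).ne'
    intro s
    linarith [hi s]
  exact le_antisymm (key k i) (key i k)

end Connected

/-! ### Injectivity of the map and of its derivative -/

section Injective

variable {n : ℕ} {A : Matrix (Fin n) (Fin n) ℝ} {a x z : Fin n → ℝ}

/-- The average of z/x over column j with weights A_kj x_k is (Aᵀz)_j / (Aᵀx)_j, and the equality of
images, divided by x_i, is the balance condition of the maximum principle. -/
theorem exists_smul_of_scalingFormula_eq (hA : ∀ i j, 0 ≤ A i j) (hcol : ∀ j, ∃ i, A i j ≠ 0)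
    (hconn : RowsConnected A) (hn : n ≠ 0) (ha : ∀ j, 0 < a j) (hx : ∀ i, 0 < x i)
    (hz : ∀ i, 0 < z i) (h : scalingFormula A a x = scalingFormula A a z) :
    ∃ t : ℝ, 0 < t ∧ z = t • x := by
  have hTx := transpose_mulVec_pos hA hcol hx
  have hTz := transpose_mulVec_pos hA hcol hz
  have hconst := eq_of_sum_sub_average_eq_zero hA hconn (c := fun j => a j / (Aᵀ *ᵥ z) j)
    (η := fun i => z i / x i) (m := fun j => (Aᵀ *ᵥ z) j / (Aᵀ *ᵥ x) j) hx
    (fun j => div_pos (ha j) (hTz j)) ?_ ?_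
  · let i₀ : Fin n := ⟨0, Nat.pos_of_ne_zero hn⟩
    refine ⟨z i₀ / x i₀, div_pos (hz _) (hx _), funext fun i => ?_⟩
    have := hconst i₀ i
    rw [Pi.smul_apply, this, smul_eq_mul, div_mul_cancel₀ _ (hx i).ne']
  · intro j
    rw [← transpose_mulVec_apply, div_mul_cancel₀ _ (hTx j).ne', transpose_mulVec_apply]
    refine sum_congr rfl fun k _ => ?_
    rw [mul_assoc, mul_div_cancel₀ _ (hx k).ne']
  · intro i
    have hi := congrFun h i
    simp only [scalingFormula] at hi
    have hterm : ∀ j, A i j * (a j / (Aᵀ *ᵥ z) j) * (z i / x i - (Aᵀ *ᵥ z) j / (Aᵀ *ᵥ x) j) =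
        (z i / x i) * (A i j * (a j / (Aᵀ *ᵥ z) j)) - A i j * (a j / (Aᵀ *ᵥ x) j) := by
      intro j
      have := (hTx j).ne'
      have := (hTz j).ne'
      have := (hx i).ne'
      field_simp
    simp only [hterm]
    rw [sum_sub_distrib, ← mul_sum, div_mul_eq_mul_div, ← hi, mul_div_cancel_left₀ _ (hx i).ne',
      sub_self]

/-- Linearised form of the previous argument: the derivative along h is x_i ∑_j A_ij (a_j / (Aᵀx)_j)
(h_i/x_i - (Aᵀh)_j/(Aᵀx)_j). -/
theorem eq_smul_of_hasDerivAt_scalingFormula (hA : ∀ i j, 0 ≤ A i j)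
    (hcol : ∀ j, ∃ i, A i j ≠ 0) (hconn : RowsConnected A) (ha : ∀ j, 0 < a j)
    (hx : ∀ i, 0 < x i) {h : Fin n → ℝ}
    (hd : ∀ i, HasDerivAt (fun t : ℝ => scalingFormula A a (x + t • h) i) 0 0) (i k : Fin n) :
    h i / x i = h k / x k := by
  have hT := transpose_mulVec_pos hA hcol hx
  refine eq_of_sum_sub_average_eq_zero hA hconn (c := fun j => a j / (Aᵀ *ᵥ x) j)
    (η := fun i => h i / x i) (m := fun j => (Aᵀ *ᵥ h) j / (Aᵀ *ᵥ x) j) hx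
    (fun j => div_pos (ha j) (hT j)) ?_ ?_ i k
  · intro j
    rw [← transpose_mulVec_apply, div_mul_cancel₀ _ (hT j).ne', transpose_mulVec_apply]
    refine sum_congr rfl fun k _ => ?_
    rw [mul_assoc, mul_div_cancel₀ _ (hx k).ne']
  · intro i
    have hlin : ∀ p q : ℝ, HasDerivAt (fun t : ℝ => p + t * q) q 0 := fun p q => by
      simpa using ((hasDerivAt_id (0 : ℝ)).mul_const q).const_add p
    have hterm : ∀ j ∈ univ, HasDerivAt
        (fun t : ℝ => A i j * (a j / ((Aᵀ *ᵥ x) j + t * (Aᵀ *ᵥ h) j)))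
        (-(A i j * (a j * (Aᵀ *ᵥ h) j / (Aᵀ *ᵥ x) j ^ 2))) 0 := fun j _ => by
      have := (((hasDerivAt_const (0 : ℝ) (a j)).div (hlin ((Aᵀ *ᵥ x) j) ((Aᵀ *ᵥ h) j))
        (by simpa using (hT j).ne')).const_mul (A i j))
      refine this.congr_deriv ?_
      simp
      ring
    have hprod := (hlin (x i) (h i)).mul (HasDerivAt.fun_sum hterm)
    have heq := (hd i).unique (hprod.congr_of_eventuallyEq (Eventually.of_forall fun t => by
      simp [scalingFormula, Matrix.mulVec_add, Matrix.mulVec_smul]))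
    simp only [zero_mul, add_zero] at heq
    rw [sum_neg_distrib, mul_neg, ← sub_eq_add_neg] at heq
    refine (mul_eq_zero.1 ?_).resolve_left (hx i).ne'
    rw [eq_comm, mul_sum, mul_sum, ← sum_sub_distrib] at heq
    rw [← heq, mul_sum]
    refine sum_congr rfl fun j _ => ?_
    have := (hT j).ne'
    have := (hx i).ne'
    field_simp

theorem sum_homogeneousScaling (hasum : ∑ j, a j = 1) (hT : ∀ j, (Aᵀ *ᵥ x) j ≠ 0) :
    ∑ i, homogeneousScaling A a x i = ∑ i, x i := by
  simp only [homogeneousScaling]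
  rw [← mul_sum, sum_scalingFormula hT, hasum, mul_one]

theorem homogeneousScaling_eq_of_mem_stdSimplex (hx : x ∈ stdSimplex ℝ (Fin n)) :
    homogeneousScaling A a x = scalingFormula A a x := by
  funext i
  rw [homogeneousScaling, hx.2, one_mul]

theorem sum_pos_of_mem_posOrthant (hn : n ≠ 0) (hx : x ∈ posOrthant n) : 0 < ∑ i, x i :=
  sum_pos (fun i _ => hx i) ⟨⟨0, Nat.pos_of_ne_zero hn⟩, mem_univ _⟩

theorem injOn_homogeneousScaling (hA : ∀ i j, 0 ≤ A i j) (hcol : ∀ j, ∃ i, A i j ≠ 0)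
    (hconn : RowsConnected A) (hn : n ≠ 0) (ha : a ∈ openSimplex n) :
    Set.InjOn (homogeneousScaling A a) (posOrthant n) := by
  intro x hx z hz h
  have hs : ∑ i, x i = ∑ i, z i := by
    rw [← sum_homogeneousScaling ha.1.2 fun j => (transpose_mulVec_pos hA hcol hx j).ne', h,
      sum_homogeneousScaling ha.1.2 fun j => (transpose_mulVec_pos hA hcol hz j).ne']
  have hpos := sum_pos_of_mem_posOrthant hn hx
  have hphi : scalingFormula A a x = scalingFormula A a z := by
    funext i
    have := congrFun h i
    simp only [homogeneousScaling, ← hs] at this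
    exact mul_left_cancel₀ hpos.ne' this
  obtain ⟨t, -, rfl⟩ := exists_smul_of_scalingFormula_eq hA hcol hconn hn ha.2 hx hz hphi
  simp only [Pi.smul_apply, smul_eq_mul, ← mul_sum] at hs
  have : t = 1 := by
    apply mul_right_cancel₀ hpos.ne'
    linarith
  rw [this, one_smul]

/-- Preservation of the coordinate sum gives ∑ h = 0 on the kernel, so the factor ∑ x is constant
along the line and φ itself has derivative zero. Then h is a multiple of x with sum zero. -/
theorem injective_fderiv_homogeneousScaling (hA : ∀ i j, 0 ≤ A i j)
    (hcol : ∀ j, ∃ i, A i j ≠ 0) (hconn : RowsConnected A) (hn : n ≠ 0)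
    (ha : a ∈ openSimplex n) (hx : x ∈ posOrthant n) :
    Function.Injective (fderiv ℝ (homogeneousScaling A a) x) := by
  refine (injective_iff_map_eq_zero _).2 fun h hh => ?_
  have hT := fun j => (transpose_mulVec_pos hA hcol hx j).ne'
  have hpos := sum_pos_of_mem_posOrthant hn hx
  have hline : HasDerivAt (fun t : ℝ => x + t • h) h 0 := by
    simpa using ((hasDerivAt_id (0 : ℝ)).smul_const h).const_add x
  have hd : HasDerivAt (fun t : ℝ => homogeneousScaling A a (x + t • h)) 0 0 := by
    have hf : HasFDerivAt (homogeneousScaling A a) (fderiv ℝ (homogeneousScaling A a) x)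
        (x + (0 : ℝ) • h) := by
      simpa using ((contDiffAt_homogeneousScaling hT).differentiableAt (by simp)).hasFDerivAt
    exact (hf.comp_hasDerivAt (0 : ℝ) hline).congr_deriv hh
  have hnear : ∀ᶠ t : ℝ in 𝓝 0, x + t • h ∈ posOrthant n :=
    hline.continuousAt.eventually_mem ((isOpen_posOrthant n).mem_nhds (by simpa using hx))
  have hsum : ∑ i, h i = 0 := by
    have h1 : HasDerivAt (fun t : ℝ => ∑ i, (x + t • h) i) (∑ i, h i) 0 :=
      HasDerivAt.fun_sum fun i _ => hasDerivAt_pi.1 hline i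
    have h2 : HasDerivAt (fun t : ℝ => ∑ i, homogeneousScaling A a (x + t • h) i)
        (∑ _i : Fin n, (0 : ℝ)) 0 :=
      HasDerivAt.fun_sum fun i _ => hasDerivAt_pi.1 hd i
    have := h1.unique (h2.congr_of_eventuallyEq (hnear.mono fun t ht =>
      (sum_homogeneousScaling ha.1.2 fun j => (transpose_mulVec_pos hA hcol ht j).ne').symm))
    simpa using this
  have hphi : ∀ i, HasDerivAt (fun t : ℝ => scalingFormula A a (x + t • h) i) 0 0 := by
    intro i
    have := (hasDerivAt_pi.1 hd i).const_mul (∑ k, x k)⁻¹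
    rw [Pi.zero_apply, mul_zero] at this
    refine this.congr_of_eventuallyEq (Eventually.of_forall fun t => ?_)
    simp only [homogeneousScaling, Pi.add_apply, Pi.smul_apply, smul_eq_mul, sum_add_distrib,
      ← mul_sum, hsum, mul_zero, add_zero]
    rw [inv_mul_cancel_left₀ hpos.ne']
  have hconst := eq_smul_of_hasDerivAt_scalingFormula hA hcol hconn ha.2 hx hphi
  funext i
  have hi : ∀ k, h k = h i / x i * x k := fun k => by
    rw [hconst i k, div_mul_cancel₀ _ (hx k).ne']
  have h0 : h i / x i * ∑ k, x k = 0 := by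
    rw [mul_sum, ← hsum]
    exact sum_congr rfl fun k _ => (hi k).symm
  rw [hi i, (mul_eq_zero.1 h0).resolve_right hpos.ne', zero_mul, Pi.zero_apply]

end Injective

/-- A smooth injective map with injective derivatives on an open subset of a finite-dimensional
space has open image and a smooth inverse. -/
theorem isOpen_image_and_contDiffOn_invFunOn {E : Type*} [NormedAddCommGroup E]
    [NormedSpace ℝ E] [FiniteDimensional ℝ E] [Nonempty E] {f : E → E} {S : Set E}
    (hS : IsOpen S) (hf : ∀ x ∈ S, ContDiffAt ℝ ∞ f x) (hinj : Set.InjOn f S)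
    (hd : ∀ x ∈ S, Function.Injective (fderiv ℝ f x)) :
    IsOpen (f '' S) ∧ ContDiffOn ℝ ∞ (Function.invFunOn f S) (f '' S) := by
  have := FiniteDimensional.complete ℝ E
  have hequiv : ∀ x ∈ S, ∃ f' : E ≃L[ℝ] E, HasFDerivAt f (f' : E →L[ℝ] E) x := by
    intro x hx
    let e : E ≃L[ℝ] E :=
      (LinearEquiv.ofInjectiveEndo (fderiv ℝ f x : E →ₗ[ℝ] E) (hd x hx)).toContinuousLinearEquiv
    refine ⟨e, ?_⟩
    have he : (e : E →L[ℝ] E) = fderiv ℝ f x := by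
      ext y
      rfl
    rw [he]
    exact ((hf x hx).differentiableAt (by simp)).hasFDerivAt
  refine ⟨isOpen_iff_mem_nhds.2 ?_, ?_⟩
  · rintro _ ⟨x, hx, rfl⟩
    obtain ⟨f', hf'⟩ := hequiv x hx
    rw [← ((hf x hx).hasStrictFDerivAt' hf' (by simp)).map_nhds_eq_of_equiv]
    exact image_mem_map (hS.mem_nhds hx)
  · rintro _ ⟨x, hx, rfl⟩
    obtain ⟨f', hf'⟩ := hequiv x hx
    have hstrict := (hf x hx).hasStrictFDerivAt' hf' (by simp)
    have hsmooth := (hf x hx).to_localInverse hf' (by simp)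
    refine (hsmooth.congr_of_eventuallyEq ?_).contDiffWithinAt
    -- By continuity the local inverse takes values in S near f x, and injectivity on S then
    -- identifies it with the global inverse.
    have hmem : ∀ᶠ y in 𝓝 (f x), (hf x hx).localInverse hf' (by simp) y ∈ S :=
      hsmooth.continuousAt.eventually_mem
        (hS.mem_nhds (by rwa [ContDiffAt.localInverse_apply_image]))
    filter_upwards [hmem, hstrict.eventually_right_inverse] with y hy hy'
    have hex : y ∈ f '' S := ⟨_, hy, hy'⟩
    exact hinj (Function.invFunOn_mem hex) hy ((Function.invFunOn_eq hex).trans hy'.symm)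

/-! ### Diffeomorphism onto a relatively open image -/

section Diffeomorphism

variable {n : ℕ} {A : Matrix (Fin n) (Fin n) ℝ} {a : Fin n → ℝ}

theorem ne_zero_of_mem_openSimplex (ha : a ∈ openSimplex n) : n ≠ 0 := by
  rintro rfl
  simpa using ha.1.2

theorem isDiffeomorphismOn_image_and_isOpen (hA : ∀ i j, 0 ≤ A i j)
    (hrow : ∀ i, ∃ j, A i j ≠ 0) (hcol : ∀ j, ∃ i, A i j ≠ 0) (ha : a ∈ openSimplex n)
    (hconn : RowsConnected A) :
    IsDiffeomorphismOn (scalingMap A a) (openSimplex n) (scalingMap A a '' openSimplex n) ∧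
      ∃ U : Set (Fin n → ℝ), IsOpen U ∧
        scalingMap A a '' openSimplex n = U ∩ openSimplex n := by
  have hn := ne_zero_of_mem_openSimplex ha
  have hT : ∀ x ∈ posOrthant n, ∀ j, (Aᵀ *ᵥ x) j ≠ 0 :=
    fun x hx j => (transpose_mulVec_pos hA hcol hx j).ne'
  have hinj := injOn_homogeneousScaling hA hcol hconn hn ha
  obtain ⟨hopen, hsmooth⟩ := isOpen_image_and_contDiffOn_invFunOn (isOpen_posOrthant n)
    (fun x hx => contDiffAt_homogeneousScaling (a := a) (hT x hx)) hinj
    (fun x hx => injective_fderiv_homogeneousScaling hA hcol hconn hn ha hx)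
  have heq : ∀ x ∈ openSimplex n, scalingMap A a x = homogeneousScaling A a x := fun x hx => by
    rw [scalingMap_eq_scalingFormula (hT x hx.2), homogeneousScaling_eq_of_mem_stdSimplex hx.1]
  have hsub : scalingMap A a '' openSimplex n ⊆ homogeneousScaling A a '' posOrthant n := by
    rintro _ ⟨x, hx, rfl⟩
    exact ⟨x, hx.2, (heq x hx).symm⟩
  have hleft : Set.LeftInvOn (Function.invFunOn (homogeneousScaling A a) (posOrthant n))
      (scalingMap A a) (openSimplex n) := fun x hx => by
    rw [heq x hx]
    exact hinj.leftInvOn_invFunOn hx.2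
  refine ⟨⟨Set.mapsTo_image _ _, smoothOnSubset_scalingMap hA hcol,
    Function.invFunOn (homogeneousScaling A a) (posOrthant n), ?_, ?_, hleft, ?_⟩,
    homogeneousScaling A a '' posOrthant n, hopen, Set.Subset.antisymm ?_ ?_⟩
  · rintro _ ⟨x, hx, rfl⟩
    rwa [hleft hx]
  · exact fun y hy => ⟨_, hopen, hsub hy, _, hsmooth, fun _ _ => rfl⟩
  · rintro _ ⟨x, hx, rfl⟩
    rw [hleft hx]
  · exact Set.subset_inter hsub (mapsTo_scalingMap hA hrow hcol ha).image_subset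
  · rintro _ ⟨⟨x, hx, rfl⟩, hy⟩
    -- A point of the orthant with image in the simplex has coordinate sum 1, since the sum is
    -- preserved.
    have hxs : x ∈ openSimplex n := ⟨⟨fun i => (hx i).le, by
      rw [← sum_homogeneousScaling ha.1.2 (hT x hx)]
      exact hy.1.2⟩, hx⟩
    exact ⟨x, hxs, heq x hxs⟩

end Diffeomorphism

/-! ### Surjectivity by maximising the potential -/

section Surjective

variable {n : ℕ} {A : Matrix (Fin n) (Fin n) ℝ} {a b : Fin n → ℝ}

/-- The logarithmic potential whose critical points are the solutions of `Φ_{A,a}(x) = b`. -/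
noncomputable def logPotential {n : ℕ} (A : Matrix (Fin n) (Fin n) ℝ) (a b x : Fin n → ℝ) : ℝ :=
  ∑ i, b i * Real.log (x i) - ∑ j, a j * Real.log ((Aᵀ *ᵥ x) j)

theorem logPotential_smul {x : Fin n → ℝ} {t : ℝ} (ht : t ≠ 0) (hx : ∀ i, x i ≠ 0)
    (hT : ∀ j, (Aᵀ *ᵥ x) j ≠ 0) (hab : ∑ i, b i = ∑ j, a j) :
    logPotential A a b (t • x) = logPotential A a b x := by
  simp only [logPotential, Matrix.mulVec_smul, Pi.smul_apply, smul_eq_mul,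
    Real.log_mul ht (hx _), Real.log_mul ht (hT _), mul_add, sum_add_distrib, ← sum_mul, hab]
  ring

theorem exists_isMaxOn_logPotential (hA : ∀ i j, 0 < A i j) (hn : n ≠ 0)
    (hb : ∀ i, 0 < b i) :
    ∃ x ∈ openSimplex n, IsMaxOn (logPotential A a b) (openSimplex n) x := by
  -- The exponential of the potential stays continuous up to the boundary, where the logarithms do
  -- not.
  let H : (Fin n → ℝ) → ℝ := fun x => (∏ i, x i ^ b i) * ∏ j, (Aᵀ *ᵥ x) j ^ (-a j)
  have hTc : ∀ j, Continuous fun x : Fin n → ℝ => (Aᵀ *ᵥ x) j := fun j => by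
    simp only [transpose_mulVec_apply]
    fun_prop
  have hH : ContinuousOn H (stdSimplex ℝ (Fin n)) := by
    refine ContinuousOn.mul ?_ ?_
    · exact continuousOn_finsetProd _ fun i _ =>
        (continuous_apply i).continuousOn.rpow_const fun x _ => Or.inr (hb i).le
    · exact continuousOn_finsetProd _ fun j _ => (hTc j).continuousOn.rpow_const fun x hx =>
        Or.inl (transpose_mulVec_pos_of_mem_stdSimplex hA hx j).ne'
  have hexp : ∀ x ∈ openSimplex n, H x = Real.exp (logPotential A a b x) := fun x hx => by
    simp only [H, logPotential, sub_eq_add_neg, ← sum_neg_distrib, Real.exp_add, Real.exp_sum]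
    congr 1 <;> refine prod_congr rfl fun i _ => ?_
    · rw [Real.rpow_def_of_pos (hx.2 i), mul_comm]
    · rw [Real.rpow_def_of_pos (transpose_mulVec_pos_of_mem_stdSimplex hA hx.1 i)]
      ring_nf
  have hn' : (0 : ℝ) < n := Nat.cast_pos.2 (Nat.pos_of_ne_zero hn)
  -- The barycentre shows that the maximum of H is positive, which excludes boundary points.
  have hc : (fun _ => (n : ℝ)⁻¹) ∈ openSimplex n :=
    ⟨⟨fun _ => (inv_pos.2 hn').le, by simp [hn'.ne']⟩, fun _ => inv_pos.2 hn'⟩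
  obtain ⟨x, hx, hmax⟩ := (isCompact_stdSimplex ℝ (Fin n)).exists_isMaxOn ⟨_, hc.1⟩ hH
  have hpos : 0 < H x := (hexp _ hc ▸ Real.exp_pos _ : 0 < H _).trans_le (hmax hc.1)
  have hxs : x ∈ openSimplex n := ⟨hx, fun i => (hx.1 i).lt_of_ne' fun h0 => by
    have : ∏ i, x i ^ b i = 0 :=
      prod_eq_zero (mem_univ i) (by rw [h0, Real.zero_rpow (hb i).ne'])
    simp [H, this] at hpos⟩
  refine ⟨x, hxs, fun y hy => ?_⟩
  have := hmax hy.1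
  simp only [Set.mem_ofPred_eq] at this ⊢
  rwa [hexp y hy, hexp x hxs, Real.exp_le_exp] at this

theorem exists_scalingFormula_eq (hA : ∀ i j, 0 < A i j) (ha : a ∈ openSimplex n)
    (hb : b ∈ openSimplex n) : ∃ x ∈ openSimplex n, scalingFormula A a x = b := by
  have hn := ne_zero_of_mem_openSimplex ha
  obtain ⟨x, hx, hmax⟩ := exists_isMaxOn_logPotential (a := a) hA hn hb.2
  have hT : ∀ y ∈ posOrthant n, ∀ j, 0 < (Aᵀ *ᵥ y) j := fun y hy =>
    transpose_mulVec_pos (fun i j => (hA i j).le) (fun j => ⟨j, (hA j j).ne'⟩) hy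
  -- Since ∑ a = ∑ b, the potential has degree 0, so the maximum on the simplex is one on the whole
  -- orthant and no Lagrange multiplier appears.
  have hglobal : ∀ y ∈ posOrthant n, logPotential A a b y ≤ logPotential A a b x := by
    intro y hy
    have hpos := sum_pos_of_mem_posOrthant hn hy
    rw [← logPotential_smul (inv_pos.2 hpos).ne' (fun i => (hy i).ne')
      (fun j => (hT y hy j).ne') (hb.1.2.trans ha.1.2.symm)]
    have hmem : ∀ i, 0 < ((∑ i, y i)⁻¹ • y) i := fun i => mul_pos (inv_pos.2 hpos) (hy i)
    refine hmax ⟨⟨fun i => (hmem i).le, ?_⟩, hmem⟩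
    simp only [Pi.smul_apply, smul_eq_mul, ← mul_sum]
    exact inv_mul_cancel₀ hpos.ne'
  refine ⟨x, hx, funext fun i => ?_⟩
  have hlin : ∀ p q : ℝ, HasDerivAt (fun t : ℝ => p + t * q) q 0 := fun p q => by
    simpa using ((hasDerivAt_id (0 : ℝ)).mul_const q).const_add p
  have hlog : ∀ w p q : ℝ, 0 < p →
      HasDerivAt (fun t : ℝ => w * Real.log (p + t * q)) (w * (q / p)) 0 := fun w p q hp => by
    simpa using ((hlin p q).log (by simpa using hp.ne')).const_mul w
  have hd := (HasDerivAt.fun_sum fun k (_ : k ∈ univ) =>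
    hlog (b k) (x k) ((Pi.single i 1 : Fin n → ℝ) k) (hx.2 k)).sub
    (HasDerivAt.fun_sum fun j (_ : j ∈ univ) =>
      hlog (a j) ((Aᵀ *ᵥ x) j) (A i j) (hT x hx.2 j))
  have hcont : ContinuousAt (fun t : ℝ => x + t • (Pi.single i 1 : Fin n → ℝ)) 0 := by fun_prop
  have hlocal : ∀ᶠ t : ℝ in 𝓝 0, x + t • (Pi.single i 1 : Fin n → ℝ) ∈ posOrthant n :=
    hcont.eventually_mem ((isOpen_posOrthant n).mem_nhds (by rw [zero_smul, add_zero]; exact hx.2))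
  have hcrit := IsLocalMax.hasDerivAt_eq_zero (hlocal.mono fun t ht => by
    simpa [logPotential, Matrix.mulVec_add, Matrix.mulVec_smul] using hglobal _ ht) hd
  rw [sum_eq_single i (fun k _ hk => by simp [hk]) (by simp), Pi.single_eq_same, sub_eq_zero,
    mul_one_div, div_eq_iff (hx.2 i).ne'] at hcrit
  rw [scalingFormula, hcrit, mul_comm]
  congr 1
  exact sum_congr rfl fun j _ => by ring

end Surjective

/-! ### Bridge systems and matrix scalings as the equation φ(u) = b -/

section Bridge

variable {n : ℕ} {A : Matrix (Fin n) (Fin n) ℝ} {a b u v x y d₁ d₂ : Fin n → ℝ}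

theorem isBridgeSolution_of_scalingFormula_eq (ha : ∀ j, 0 < a j) (hb : ∀ i, 0 < b i)
    (hT : ∀ j, 0 < (Aᵀ *ᵥ u) j) (hu : ∀ i, 0 < u i) (h : scalingFormula A a u = b) :
    IsBridgeSolution A a b u (Aᵀ *ᵥ u) (fun j => a j / (Aᵀ *ᵥ u) j)
      (A *ᵥ fun j => a j / (Aᵀ *ᵥ u) j) := by
  have hb' : b = u * (A *ᵥ fun j => a j / (Aᵀ *ᵥ u) j) := h.symm
  refine ⟨hu, hT, fun j => div_pos (ha j) (hT j), fun i => ?_, rfl, rfl, ?_, hb'⟩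
  · have hi := hb i
    rw [hb', Pi.mul_apply] at hi
    exact pos_of_mul_pos_right hi (hu i).le
  · funext j
    exact (mul_div_cancel₀ _ (hT j).ne').symm

theorem IsBridgeSolution.scalingFormula_eq (h : IsBridgeSolution A a b u v x y) :
    x = (fun j => a j / (Aᵀ *ᵥ u) j) ∧ scalingFormula A a u = b := by
  obtain ⟨-, hv, -, -, rfl, rfl, rfl, rfl⟩ := h
  have hx : x = fun j => ((Aᵀ *ᵥ u) * x) j / (Aᵀ *ᵥ u) j :=
    funext fun j => (mul_div_cancel_left₀ _ (hv j).ne').symm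
  refine ⟨hx, ?_⟩
  conv_rhs => rw [hx]
  rfl

theorem isBridgeScaling_iff (hA : ∀ i j, 0 ≤ A i j) :
    IsBridgeScaling A a b d₁ d₂ ↔ (∀ i, 0 < d₁ i) ∧ (∀ j, 0 < d₂ j) ∧
      (∀ j, (Aᵀ *ᵥ d₁) j * d₂ j = 1) ∧ d₁ * (A *ᵥ (d₂ * a)) = b := by
  have hent : ∀ i j, (Matrix.diagonal d₁ * A * Matrix.diagonal d₂) i j = d₁ i * A i j * d₂ j :=
    fun i j => by rw [Matrix.mul_diagonal, Matrix.diagonal_mul]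
  have hmul : (Matrix.diagonal d₁ * A * Matrix.diagonal d₂) *ᵥ a = d₁ * (A *ᵥ (d₂ * a)) := by
    rw [← Matrix.mulVec_mulVec, ← Matrix.mulVec_mulVec]
    funext i
    rw [Matrix.mulVec_diagonal, Pi.mul_apply]
    congr 2
    funext j
    rw [Matrix.mulVec_diagonal, Pi.mul_apply]
  have hsum : ∀ j, ∑ i, d₁ i * A i j * d₂ j = (Aᵀ *ᵥ d₁) j * d₂ j := fun j => by
    rw [transpose_mulVec_apply, sum_mul]
    exact sum_congr rfl fun i _ => by ring
  rw [IsBridgeScaling, Matrix.mem_colStochastic_iff_sum, hmul]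
  simp only [hent, hsum]
  refine and_congr_right fun h₁ => and_congr_right fun h₂ => ?_
  rw [and_iff_right fun i j => mul_nonneg (mul_nonneg (h₁ i).le (hA i j)) (h₂ j).le]

theorem isBridgeScaling_of_scalingFormula_eq (hA : ∀ i j, 0 ≤ A i j)
    (hT : ∀ j, 0 < (Aᵀ *ᵥ d₁) j) (hd : ∀ i, 0 < d₁ i) (h : scalingFormula A a d₁ = b) :
    IsBridgeScaling A a b d₁ fun j => ((Aᵀ *ᵥ d₁) j)⁻¹ := by
  refine (isBridgeScaling_iff hA).2 ⟨hd, fun j => inv_pos.2 (hT j),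
    fun j => mul_inv_cancel₀ (hT j).ne', ?_⟩
  rw [← h, scalingFormula_eq_mul]

theorem IsBridgeScaling.scalingFormula_eq (hA : ∀ i j, 0 ≤ A i j)
    (h : IsBridgeScaling A a b d₁ d₂) :
    d₂ = (fun j => ((Aᵀ *ᵥ d₁) j)⁻¹) ∧ scalingFormula A a d₁ = b := by
  obtain ⟨-, -, h₁, rfl⟩ := (isBridgeScaling_iff hA).1 h
  have hd : d₂ = fun j => ((Aᵀ *ᵥ d₁) j)⁻¹ := funext fun j => eq_inv_of_mul_eq_one_right (h₁ j)
  exact ⟨hd, by rw [scalingFormula_eq_mul, ← hd]⟩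

end Bridge

theorem theorem2p1 (n : ℕ) (A : Matrix (Fin n) (Fin n) ℝ) (a : Fin n → ℝ)
    (hA : ∀ i j, 0 ≤ A i j)
    (hrow : ∀ i, ∃ j, A i j ≠ 0) (hcol : ∀ j, ∃ i, A i j ≠ 0)
    (ha : a ∈ openSimplex n) :
    -- the map is a well-defined smooth self-map of the open simplex
    (Set.MapsTo (scalingMap A a) (openSimplex n) (openSimplex n) ∧
      SmoothOnSubset (scalingMap A a) (openSimplex n)) ∧
    -- part 1
    ((∀ i j, 0 < A i j) →
      (∃ F : (Fin n → ℝ) → (Fin n → ℝ),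
        Set.EqOn F (scalingMap A a) (openSimplex n) ∧
        ContinuousOn F (stdSimplex ℝ (Fin n)) ∧
        Set.MapsTo F (stdSimplex ℝ (Fin n)) (stdSimplex ℝ (Fin n)) ∧
        Set.MapsTo F (simplexBoundary n) (simplexBoundary n)) ∧
      IsDiffeomorphismOn (scalingMap A a) (openSimplex n) (openSimplex n) ∧
      -- unique solvability of the bridge problem, as a system and as a matrix scaling
      ∀ b ∈ openSimplex n,
        (∃ u v x y : Fin n → ℝ, IsBridgeSolution A a b u v x y ∧
          ∀ u' v' x' y' : Fin n → ℝ, IsBridgeSolution A a b u' v' x' y' →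
            ∃ t : ℝ, 0 < t ∧ u' = t • u ∧ v' = t • v ∧ x' = t⁻¹ • x ∧ y' = t⁻¹ • y) ∧
        (∃ d₁ d₂ : Fin n → ℝ, IsBridgeScaling A a b d₁ d₂ ∧
          ∀ d₁' d₂' : Fin n → ℝ, IsBridgeScaling A a b d₁' d₂' →
            ∃ t : ℝ, 0 < t ∧ d₁' = t • d₁ ∧ d₂' = t⁻¹ • d₂)) ∧
    -- part 2
    ((A * Aᵀ).IsIrreducible →
      IsDiffeomorphismOn (scalingMap A a) (openSimplex n)
        (scalingMap A a '' openSimplex n) ∧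
      ∃ U : Set (Fin n → ℝ), IsOpen U ∧
        scalingMap A a '' openSimplex n = U ∩ openSimplex n) := by
  have hmaps := mapsTo_scalingMap hA hrow hcol ha
  have hn := ne_zero_of_mem_openSimplex ha
  refine ⟨⟨hmaps, smoothOnSubset_scalingMap hA hcol⟩, fun hpos => ?_, fun hirr =>
    isDiffeomorphismOn_image_and_isOpen hA hrow hcol ha (rowsConnected_of_isIrreducible hA hirr)⟩
  have hT : ∀ x ∈ stdSimplex ℝ (Fin n), ∀ j, 0 < (Aᵀ *ᵥ x) j := fun x hx =>
    transpose_mulVec_pos_of_mem_stdSimplex hpos hx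
  have hconn := rowsConnected_of_pos hpos
  have hstd : ∀ x ∈ stdSimplex ℝ (Fin n), scalingFormula A a x ∈ stdSimplex ℝ (Fin n) :=
    fun x hx => scalingFormula_mem_stdSimplex hA ha.1 (hT x hx) hx.1
  refine ⟨⟨scalingFormula A a, fun x hx => ?_, fun x hx => ?_, hstd, fun x hx => ?_⟩, ?_, ?_⟩
  · exact (scalingMap_eq_scalingFormula fun j => (hT x hx.1 j).ne').symm
  · exact (contDiffAt_scalingFormula fun j => (hT x hx j).ne').continuousAt.continuousWithinAt
  -- The factor x_i keeps every zero coordinate zero.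
  · refine ⟨hstd x hx.1, fun h => hx.2 ⟨hx.1, fun i => (hx.1.1 i).lt_of_ne' fun h0 => ?_⟩⟩
    have := h.2 i
    rw [scalingFormula, h0, zero_mul] at this
    exact this.false
  · have himage : scalingMap A a '' openSimplex n = openSimplex n := by
      refine hmaps.image_subset.antisymm fun b hb => ?_
      obtain ⟨x, hx, hxb⟩ := exists_scalingFormula_eq hpos ha hb
      exact ⟨x, hx, (scalingMap_eq_scalingFormula fun j => (hT x hx.1 j).ne').trans hxb⟩
    have := (isDiffeomorphismOn_image_and_isOpen hA hrow hcol ha hconn).1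
    rwa [himage] at this
  · intro b hb
    obtain ⟨u, hu, hub⟩ := exists_scalingFormula_eq hpos ha hb
    have huniq : ∀ u' : Fin n → ℝ, (∀ i, 0 < u' i) → scalingFormula A a u' = b →
        ∃ t : ℝ, 0 < t ∧ u' = t • u := fun u' hu' h =>
      exists_smul_of_scalingFormula_eq hA hcol hconn hn ha.2 hu.2 hu' (hub.trans h.symm)
    refine ⟨⟨u, _, _, _, isBridgeSolution_of_scalingFormula_eq ha.2 hb.2 (hT u hu.1) hu.2 hub,
      fun u' v' x' y' h => ?_⟩, u, _,
      isBridgeScaling_of_scalingFormula_eq hA (hT u hu.1) hu.2 hub, fun d₁' d₂' h => ?_⟩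
    · obtain ⟨hx', hb'⟩ := h.scalingFormula_eq
      obtain ⟨t, ht, rfl⟩ := huniq u' h.1 hb'
      -- Replacing u by t u multiplies Aᵀu by t, hence divides x = a / (Aᵀu) by t.
      have hxt : x' = t⁻¹ • fun j => a j / (Aᵀ *ᵥ u) j := by
        rw [hx']
        funext j
        simp only [Matrix.mulVec_smul, Pi.smul_apply, smul_eq_mul]
        rw [div_mul_eq_div_div_swap, div_eq_inv_mul _ t]
      obtain ⟨-, -, -, -, hv, hy, -, -⟩ := h
      refine ⟨t, ht, rfl, by rw [hv, Matrix.mulVec_smul], hxt, ?_⟩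
      rw [hy, hxt, Matrix.mulVec_smul]
    · obtain ⟨hd, hb'⟩ := h.scalingFormula_eq hA
      obtain ⟨t, ht, rfl⟩ := huniq d₁' h.1 hb'
      refine ⟨t, ht, rfl, ?_⟩
      rw [hd]
      funext j
      simp only [Matrix.mulVec_smul, Pi.smul_apply, smul_eq_mul]
      rw [mul_inv]
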